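/- For a language $L\subseteq\Sigma^*$ over a finite non-empty alphabet $\Sigma$, let $\kappa(L)$ be its quotient complexity, i.e. the number of distinct left quotients $L_w=\{x\in\Sigma^*\mid wx\in L\}$, $w\in\Sigma^*$, and let $L^R$ be its reverse. Star-free languages are those obtained from finite languages by boolean operations (including complement in $\Sigma^*$) and concatenation. For every $n\ge 1$ there is a star-free language $L$ with $\kappa(L)=n$ and $\kappa(L^R)=2^n-1$. More precisely, such an $L$ exists over every finite alphabet $\Sigma$ satisfying $|\Sigma|\ge 1$ if $n=1$, $|\Sigma|\ge 2$ if $n=2$, and $|\Sigma|\ge n-1$ if $n\ge 3$. Moreover, for $n\ge 3$ such an $L$ over the $(n-1)$-letter alphabet $\{a,b,c_3,\dots,c_{n-1}\}$ is the language accepted by the DFA with state set $\{1,\dots,n\}$, initial state $1$, the even states as accepting states, and transitions $\delta(i,a)=i+1$ for $1\le i\le n-1$, $\delta(n,a)=n$; $\delta(i,b)=i-1$ for $2\le i\le n$, $\delta(1,b)=1$; and, for $3\le j\le n-1$, $\delta(j,c_j)=j-1$ and $\delta(i,c_j)=i$ for $i\ne j$. -/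

import Mathlib

/-- The star-free languages over `α`: the smallest class of languages that contains the finite
languages and is closed under the boolean operations (union, intersection, complement) and under
concatenation. -/
inductive IsStarFree {α : Type*} : Language α → Prop
  | finite (L : Language α) (h : Set.Finite {w : List α | w ∈ L}) : IsStarFree L
  | union {K L : Language α} (hK : IsStarFree K) (hL : IsStarFree L) : IsStarFree (K ⊔ L)
  | inter {K L : Language α} (hK : IsStarFree K) (hL : IsStarFree L) : IsStarFree (K ⊓ L)
  | compl {L : Language α} (hL : IsStarFree L) : IsStarFree Lᶜ
  | concat {K L : Language α} (hK : IsStarFree K) (hL : IsStarFree L) : IsStarFree (K * L)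

/-- The quotient complexity `κ(L)`: the number of distinct left quotients
`{x | w ++ x ∈ L}` of `L`, where `w` ranges over all words (`⊤` if there are infinitely many). -/
noncomputable def quotientComplexity {α : Type*} (L : Language α) : ℕ∞ :=
  (Set.range L.leftQuotient).encard

/-- The alphabet `{a, b, c_3, …, c_{n-1}}`. -/
inductive ReversalLetter (n : ℕ) : Type
  | a : ReversalLetter n
  | b : ReversalLetter n
  | c (j : ℕ) (h3 : 3 ≤ j) (hj : j ≤ n - 1) : ReversalLetter n

/-- The DFA with state set `{1, …, n}`, initial state `1`, accepting states the even ones, where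
`a` sends `i` to `i + 1` (and fixes `n`), `b` sends `i` to `i - 1` (and fixes `1`), and `c_j` sends
`j` to `j - 1` and fixes every other state. -/
def reversalDFA (n : ℕ) (hn : 3 ≤ n) : DFA (ReversalLetter n) (Set.Icc 1 n) where
  step i x :=
    match x with
    | .a => if h : i.1 = n then i else ⟨i.1 + 1, by have := i.2.1; have := i.2.2; grind⟩
    | .b => if h : i.1 = 1 then i else ⟨i.1 - 1, by have := i.2.1; have := i.2.2; grind⟩
    | .c j h3 hj => if i.1 = j then ⟨j - 1, by grind⟩ else i
  start := ⟨1, by grind⟩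
  accept := {i | Even i.1}

/-
Every letter acts monotonically on the chain `1 < ⋯ < n`, and a finite automaton with a monotone
action on a chain accepts a star-free language. To see this, let `a` be the largest state that a
transition can reach, `b` the state just below it, and cut every transition off at `b`. A run that
ends below `a` either never goes above `b`, or splits at the letter that leaves `a` for the last
time; both situations are described by the cut-off automaton, to which induction applies. The
prefix up to the splitting letter need not be required to end in `a`: it ends in some state `≤ a`,
and by monotonicity the remaining run then ends no higher than a run started in `a`.

The quotients of the reverse correspond to the sets of states from which a given word is accepted,
that is, to the preimages of the even states under the maps induced by words. Words induce every
monotone self-map of `{1, …, n}` without gaps in its range (such a map factors through a pointwise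
larger one and a letter `b` or `c_j`, unless it is the action of a power of `a`), and every set but
the set of odd states is the preimage of the even states under such a map. The odd states are not:
`i ∈ φ⁻¹(even) ↔ i odd` and monotonicity would force `i < φ i` for all `i`.
-/

namespace IsStarFree

variable {α : Type*}

theorem congr {K L : Language α} (hK : IsStarFree K) (h : ∀ w, w ∈ L ↔ w ∈ K) :
    IsStarFree L :=
  Language.ext h ▸ hK

theorem zero : IsStarFree (0 : Language α) :=
  finite 0 Set.finite_empty

theorem top : IsStarFree (⊤ : Language α) := by
  rw [← compl_bot]
  exact zero.compl

theorem iSup {ι : Type*} [Finite ι] {L : ι → Language α} (hL : ∀ i, IsStarFree (L i)) :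
    IsStarFree (⨆ i, L i) := by
  cases nonempty_fintype ι
  rw [← Finset.sup_univ_eq_iSup]
  exact Finset.sup_induction zero (fun _ hK _ hL => hK.union hL) fun i _ => hL i

/-- The marked product: `p` and `s` range over languages that may depend on the letter between
them. -/
theorem exists_eq_append_cons [Finite α] {K L : α → Language α} (hK : ∀ x, IsStarFree (K x))
    (hL : ∀ x, IsStarFree (L x)) :
    IsStarFree {w : List α | ∃ p x s, w = p ++ x :: s ∧ p ∈ K x ∧ s ∈ L x} := by
  have hunion : IsStarFree (⨆ x, K x * ({[x]} * L x)) :=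
    iSup fun x => (hK x).concat ((finite _ (Set.finite_singleton [x])).concat (hL x))
  refine hunion.congr fun w => Iff.trans ?_ Language.mem_iSup.symm
  constructor
  · rintro ⟨p, x, s, rfl, hp, hs⟩
    exact ⟨x, Language.append_mem_mul hp (Language.append_mem_mul (Set.mem_singleton [x]) hs)⟩
  · rintro ⟨x, p, hp, _, ⟨_, rfl, s, hs, rfl⟩, rfl⟩
    exact ⟨p, x, s, rfl, hp, hs⟩

theorem setOf_mem {σ : Type*} [PartialOrder σ] [Finite σ] {φ : List α → σ}
    (hφ : ∀ j, IsStarFree {w | φ w ≤ j}) (E : Set σ) : IsStarFree {w | φ w ∈ E} := by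
  have hlt (k : σ) : IsStarFree {w | φ w < k} := by
    refine (iSup fun j : Set.Iio k => hφ j).congr fun w => Iff.trans ?_ Language.mem_iSup.symm
    exact ⟨fun h => ⟨⟨φ w, h⟩, le_rfl⟩, fun ⟨j, h⟩ => lt_of_le_of_lt h j.2⟩
  refine (iSup fun k : E => (hφ k).inter (hlt k).compl).congr fun w =>
    Iff.trans ?_ Language.mem_iSup.symm
  constructor
  · exact fun h => ⟨⟨φ w, h⟩, le_rfl, lt_irrefl (φ w)⟩
  · rintro ⟨k, hle, hnlt⟩
    have heq : φ w = k := (lt_or_eq_of_le hle).resolve_left hnlt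
    exact (heq.symm ▸ k.2 : φ w ∈ E)

end IsStarFree

section Monotone

variable {α σ : Type*} [LinearOrder σ] {M : DFA α σ} {a b i j : σ} {w : List α}

/-- The automaton `M` with every transition cut off at the state `b`. The monotone case of
star-freeness is reduced to it, as it moves in a smaller chain than `M`. -/
def cappedDFA (M : DFA α σ) (b : σ) : DFA α σ where
  step q x := min (M.step q x) b
  start := M.start
  accept := M.accept

/-- The words on which the run of `M` from `i` takes a transition to a state above `b`. That
transition is detected in the run of `cappedDFA M b`, which agrees with that of `M` until then. -/
def overflow (M : DFA α σ) (b i : σ) : Language α :=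
  {w | ∃ p x s, w = p ++ x :: s ∧ b < M.step ((cappedDFA M b).evalFrom i p) x}

theorem nil_notMem_overflow : [] ∉ overflow M b i := by
  rintro ⟨p, x, s, h, -⟩
  simp at h

theorem append_singleton_mem_overflow {x : α} : w ++ [x] ∈ overflow M b i ↔
    w ∈ overflow M b i ∨ b < M.step ((cappedDFA M b).evalFrom i w) x := by
  constructor
  · rintro ⟨p, y, s, h, hlt⟩
    rcases s.eq_nil_or_concat with rfl | ⟨s, z, rfl⟩
    · obtain ⟨rfl, ⟨⟩⟩ := List.append_inj' h rfl
      exact .inr hlt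
    · rw [List.concat_eq_append, ← List.cons_append, ← List.append_assoc] at h
      exact .inl ⟨p, y, s, (List.append_inj' h rfl).1, hlt⟩
  · rintro (⟨p, y, s, rfl, hlt⟩ | hlt)
    · exact ⟨p, y, s ++ [x], by simp, hlt⟩
    · exact ⟨w, x, [], rfl, hlt⟩

theorem evalFrom_cappedDFA_of_notMem_overflow (hw : w ∉ overflow M b i) :
    (cappedDFA M b).evalFrom i w = M.evalFrom i w := by
  induction w using List.reverseRecOn with
  | nil => rfl
  | append_singleton w x ih =>
    rw [append_singleton_mem_overflow, not_or, not_lt] at hw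
    rw [DFA.evalFrom_append_singleton, DFA.evalFrom_append_singleton, ← ih hw.1]
    exact min_eq_left hw.2

theorem evalFrom_cappedDFA_le (hM : ∀ x, Monotone (M.step · x)) :
    (cappedDFA M b).evalFrom i w ≤ M.evalFrom i w := by
  induction w using List.reverseRecOn with
  | nil => rfl
  | append_singleton w x ih =>
    rw [DFA.evalFrom_append_singleton, DFA.evalFrom_append_singleton]
    exact (min_le_left _ _).trans (hM x ih)

theorem monotone_cappedDFA (hM : ∀ x, Monotone (M.step · x)) (x : α) :
    Monotone ((cappedDFA M b).step · x) :=
  fun _ _ h => min_le_min_right b (hM x h)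

theorem monotone_evalFrom (hM : ∀ x, Monotone (M.step · x)) (w : List α) :
    Monotone (M.evalFrom · w) := by
  induction w with
  | nil => exact monotone_id
  | cons x w ih => exact ih.comp (hM x)

theorem evalFrom_le_of_mem_overflow (hMa : ∀ q x, M.step q x ≤ a) (hw : w ∈ overflow M b i) :
    M.evalFrom i w ≤ a := by
  rcases w.eq_nil_or_concat' with rfl | ⟨w, x, rfl⟩
  · exact absurd hw nil_notMem_overflow
  · rw [DFA.evalFrom_append_singleton]
    exact hMa _ _

theorem evalFrom_append_singleton_of_overflow (hab : b ⋖ a) (hMa : ∀ q x, M.step q x ≤ a) {x : α}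
    (hw : w ∉ overflow M b i) (hwx : w ++ [x] ∈ overflow M b i) :
    M.evalFrom i (w ++ [x]) = a := by
  have hlt := (append_singleton_mem_overflow.1 hwx).resolve_left hw
  rw [evalFrom_cappedDFA_of_notMem_overflow hw] at hlt
  rw [DFA.evalFrom_append_singleton]
  exact le_antisymm (hMa _ _) (hab.ge_of_gt hlt)

theorem evalFrom_eq_or_exists_last_overflow (hab : b ⋖ a) (hMa : ∀ q x, M.step q x ≤ a)
    (hw : w ∈ overflow M b i) : M.evalFrom i w = a ∨ ∃ p x s, w = p ++ x :: s ∧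
      p ∈ overflow M b i ∧ M.evalFrom i p = a ∧ s ∉ overflow M b (M.step a x) := by
  induction w using List.reverseRecOn with
  | nil => exact absurd hw nil_notMem_overflow
  | append_singleton w y ih =>
    by_cases hw' : w ∈ overflow M b i
    · rcases ih hw' with heq | ⟨p, x, s, rfl, hp, heq, hs⟩
      · exact .inr ⟨w, y, [], rfl, hw', heq, nil_notMem_overflow⟩
      · by_cases hsy : s ++ [y] ∈ overflow M b (M.step a x)
        · left
          rw [List.append_assoc, DFA.evalFrom_of_append, heq, List.cons_append, DFA.evalFrom_cons]
          exact evalFrom_append_singleton_of_overflow hab hMa hs hsy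
        · exact .inr ⟨p, x, s ++ [y], by simp, hp, heq, hsy⟩
    · exact .inl (evalFrom_append_singleton_of_overflow hab hMa hw' hw)

theorem evalFrom_le_iff (hM : ∀ x, Monotone (M.step · x)) (hab : b ⋖ a)
    (hMa : ∀ q x, M.step q x ≤ a) (hja : j < a) : M.evalFrom i w ≤ j ↔
      (w ∉ overflow M b i ∧ (cappedDFA M b).evalFrom i w ≤ j) ∨
      ∃ p x s, w = p ++ x :: s ∧ p ∈ overflow M b i ∧
        s ∉ overflow M b (M.step a x) ∧ (cappedDFA M b).evalFrom (M.step a x) s ≤ j := by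
  constructor
  · intro hle
    by_cases hw : w ∈ overflow M b i
    · rcases evalFrom_eq_or_exists_last_overflow hab hMa hw with heq | ⟨p, x, s, rfl, hp, heq, hs⟩
      · exact absurd (heq ▸ hle) hja.not_ge
      · rw [DFA.evalFrom_of_append, DFA.evalFrom_cons, heq] at hle
        exact .inr ⟨p, x, s, rfl, hp, hs, (evalFrom_cappedDFA_le hM).trans hle⟩
    · exact .inl ⟨hw, (evalFrom_cappedDFA_le hM).trans hle⟩
  · rintro (⟨hw, hle⟩ | ⟨p, x, s, rfl, hp, hs, hle⟩)
    · rwa [← evalFrom_cappedDFA_of_notMem_overflow hw]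
    · rw [evalFrom_cappedDFA_of_notMem_overflow hs] at hle
      rw [DFA.evalFrom_of_append]
      exact (monotone_evalFrom hM (x :: s) (evalFrom_le_of_mem_overflow hMa hp)).trans hle

theorem isStarFree_evalFrom_le_of_forall_step_le (hj : ∀ q x, M.step q x ≤ j) :
    IsStarFree {w | M.evalFrom i w ≤ j} := by
  have hfin : IsStarFree {w | ¬ M.evalFrom i w ≤ j} := by
    refine .finite _ ((Set.finite_singleton []).subset fun w hw => ?_)
    rcases w.eq_nil_or_concat' with rfl | ⟨w, x, rfl⟩
    · rfl
    · have hle : M.evalFrom i (w ++ [x]) ≤ j := by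
        rw [DFA.evalFrom_append_singleton]
        exact hj _ x
      exact absurd hle hw
  rw [← compl_compl {w | M.evalFrom i w ≤ j}]
  exact hfin.compl

theorem isStarFree_overflow [Finite α]
    (hE : ∀ E : Set σ, IsStarFree {w | (cappedDFA M b).evalFrom i w ∈ E}) :
    IsStarFree (overflow M b i) := by
  refine (IsStarFree.exists_eq_append_cons (fun x => hE {q | b < M.step q x})
    fun _ => .top).congr fun w => ?_
  exact ⟨fun ⟨p, x, s, hw, hlt⟩ => ⟨p, x, s, hw, hlt, trivial⟩,
    fun ⟨p, x, s, hw, hlt, _⟩ => ⟨p, x, s, hw, hlt⟩⟩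

theorem isStarFree_evalFrom_le [Finite α] [Finite σ] (hM : ∀ x, Monotone (M.step · x))
    (hMa : ∀ q x, M.step q x ≤ a) (i j : σ) : IsStarFree {w | M.evalFrom i w ≤ j} := by
  induction a using WellFoundedLT.induction generalizing M i j with
  | ind a ih =>
  rcases le_or_gt a j with haj | hja
  · exact isStarFree_evalFrom_le_of_forall_step_le fun q x => (hMa q x).trans haj
  obtain ⟨b, -, hab⟩ := hja.exists_le_covby
  have hcap (i j : σ) : IsStarFree {w | (cappedDFA M b).evalFrom i w ≤ j} :=
    ih b hab.lt (monotone_cappedDFA hM) (fun _ _ => min_le_right _ _) i j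
  have hover (i : σ) : IsStarFree (overflow M b i) :=
    isStarFree_overflow fun E => .setOf_mem (hcap i) E
  have hstay (i : σ) :
      IsStarFree {w | w ∉ overflow M b i ∧ (cappedDFA M b).evalFrom i w ≤ j} :=
    (hover i).compl.inter (hcap i j)
  exact ((hstay i).union (.exists_eq_append_cons (fun _ => hover i)
    fun x => hstay (M.step a x))).congr fun w => evalFrom_le_iff hM hab hMa hja

theorem isStarFree_accepts_of_monotone [Finite α] [Finite σ] (hM : ∀ x, Monotone (M.step · x)) :
    IsStarFree M.accepts := by
  have : Nonempty σ := ⟨M.start⟩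
  obtain ⟨a, ha⟩ := Finite.exists_max (id : σ → σ)
  exact .setOf_mem (isStarFree_evalFrom_le hM (fun _ _ => ha _) M.start) M.accept

end Monotone

section QuotientComplexity

theorem quotientComplexity_zero {α : Type*} : quotientComplexity (0 : Language α) = 1 := by
  have hconst : Language.leftQuotient (0 : Language α) = fun _ => 0 := rfl
  rw [quotientComplexity, hconst, Set.range_const, Set.encard_singleton]

/-- The inverse image of a language under the letter-to-letter homomorphism given by `g`; it
transfers a language to a larger alphabet. -/
def letterPreimage {α β : Type*} (g : α → β) (L : Language β) : Language α :=
  {w | w.map g ∈ L}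

theorem reverse_letterPreimage {α β : Type*} (g : α → β) (L : Language β) :
    (letterPreimage g L).reverse = letterPreimage g L.reverse := by
  refine Language.ext fun w => ?_
  change w.reverse.map g ∈ L ↔ (w.map g).reverse ∈ L
  rw [List.map_reverse]

theorem quotientComplexity_letterPreimage {α β : Type*} {g : α → β} (hg : Function.Surjective g)
    (L : Language β) : quotientComplexity (letterPreimage g L) = quotientComplexity L := by
  have hmap : Function.Surjective (List.map g) := List.map_surjective_iff.2 hg
  have hinj : Function.Injective (letterPreimage g) := hmap.preimage_injective
  have hquot : (letterPreimage g L).leftQuotient =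
      letterPreimage g ∘ L.leftQuotient ∘ List.map g := by
    funext w
    refine Language.ext fun y => ?_
    change (w ++ y).map g ∈ L ↔ w.map g ++ y.map g ∈ L
    rw [List.map_append]
  rw [quotientComplexity, hquot, Set.range_comp, hinj.encard_image,
    hmap.range_comp, quotientComplexity]

variable {α σ : Type*} (M : DFA α σ)

theorem accepts_comap_eq_letterPreimage {β : Type*} (g : β → α) :
    (M.comap g).accepts = letterPreimage g M.accepts :=
  M.accepts_comap g

theorem quotientComplexity_accepts (hreach : Function.Surjective M.eval)
    (hsep : Function.Injective M.acceptsFrom) : quotientComplexity M.accepts = ENat.card σ := by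
  rw [quotientComplexity, Language.leftQuotient_accepts, hreach.range_comp,
    ← Set.image_univ, hsep.encard_image, Set.encard_univ]

/-- The set of states from which `M` accepts the word `w`; these sets are the states of the
determinized reversal of `M`. -/
def acceptingStates (w : List α) : Set σ := {q | w ∈ M.acceptsFrom q}

theorem quotientComplexity_reverse_accepts (hreach : Function.Surjective M.eval) :
    quotientComplexity M.accepts.reverse = (Set.range (acceptingStates M)).encard := by
  let F : Set σ → Language α := fun S => {y | M.eval y.reverse ∈ S}
  have hinj : Function.Injective F :=
    (hreach.comp List.reverse_surjective).preimage_injective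
  have hquot : M.accepts.reverse.leftQuotient = F ∘ acceptingStates M ∘ List.reverse := by
    funext w
    refine Language.ext fun y => ?_
    change M.evalFrom M.start (w ++ y).reverse ∈ M.accept ↔
      M.evalFrom (M.evalFrom M.start y.reverse) w.reverse ∈ M.accept
    rw [List.reverse_append, DFA.evalFrom_of_append]
  rw [quotientComplexity, hquot, Set.range_comp, hinj.encard_image,
    List.reverse_surjective.range_comp]

end QuotientComplexity

section ChainMaps

open Set

variable {n : ℕ} {φ ψ : ℕ → ℕ}

/-- The action of a letter on states, extended to all of `ℕ` to allow arithmetic without membership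
proofs; only its values on `{1, …, n}` matter. -/
def letterMap (n : ℕ) : ReversalLetter n → ℕ → ℕ
  | .a, i => min (i + 1) n
  | .b, i => max (i - 1) 1
  | .c j _ _, i => if i = j then j - 1 else i

/-- The action of a word on states, its letters acting from left to right. -/
def wordMap (n : ℕ) (w : List (ReversalLetter n)) (i : ℕ) : ℕ :=
  w.foldl (fun q x => letterMap n x q) i

theorem wordMap_append_singleton (w : List (ReversalLetter n)) (x : ReversalLetter n) (i : ℕ) :
    wordMap n (w ++ [x]) i = letterMap n x (wordMap n w i) := by
  simp only [wordMap, List.foldl_append, List.foldl_cons, List.foldl_nil]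

theorem monotone_letterMap (x : ReversalLetter n) : Monotone (letterMap n x) := by
  intro i k hik
  cases x <;> simp only [letterMap] <;> grind

theorem mapsTo_letterMap (x : ReversalLetter n) :
    MapsTo (letterMap n x) (Icc 1 n) (Icc 1 n) := by
  intro i hi
  rw [mem_Icc] at hi ⊢
  cases x <;> simp only [letterMap] <;> grind

theorem monotone_wordMap (w : List (ReversalLetter n)) : Monotone (wordMap n w) := by
  induction w with
  | nil => exact monotone_id
  | cons x w ih => exact ih.comp (monotone_letterMap x)

theorem mapsTo_wordMap (w : List (ReversalLetter n)) :
    MapsTo (wordMap n w) (Icc 1 n) (Icc 1 n) := by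
  induction w with
  | nil => exact mapsTo_id _
  | cons x w ih => exact ih.comp (mapsTo_letterMap x)

theorem wordMap_replicate_a {i : ℕ} (hi : i ≤ n) (k : ℕ) :
    wordMap n (.replicate k .a) i = min (i + k) n := by
  induction k with
  | zero => exact (min_eq_left hi).symm
  | succ k ih =>
    rw [List.replicate_succ', wordMap_append_singleton, ih]
    simp only [letterMap]
    lia

/-- The monotone self-maps of `{1, …, n}` that skip no state of their range. They are the maps
through which the preimages of the accepting states are obtained. -/
structure IsUnitStepMap (n : ℕ) (φ : ℕ → ℕ) : Prop where
  mapsTo : MapsTo φ (Icc 1 n) (Icc 1 n)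
  succ_eq_or : ∀ i, 1 ≤ i → i < n → φ (i + 1) = φ i ∨ φ (i + 1) = φ i + 1

/-- The map `φ` agrees on `{1, …, n}` with the action of some word. -/
def IsWordMap (n : ℕ) (φ : ℕ → ℕ) : Prop :=
  ∃ w, EqOn (wordMap n w) φ (Icc 1 n)

namespace IsWordMap

theorem letterMap_comp (hψ : IsWordMap n ψ) (x : ReversalLetter n)
    (h : EqOn φ (letterMap n x ∘ ψ) (Icc 1 n)) : IsWordMap n φ := by
  obtain ⟨w, hw⟩ := hψ
  refine ⟨w ++ [x], fun i hi => ?_⟩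
  rw [wordMap_append_singleton, hw hi, h hi, Function.comp_apply]

theorem comp_letterMap (hψ : IsWordMap n ψ) (x : ReversalLetter n)
    (h : EqOn φ (ψ ∘ letterMap n x) (Icc 1 n)) : IsWordMap n φ := by
  obtain ⟨w, hw⟩ := hψ
  exact ⟨x :: w, fun i hi => (hw (mapsTo_letterMap x hi)).trans (h hi).symm⟩

end IsWordMap

/-- The room left above `φ` in `{1, …, n}`, on which the generation of unit step maps inducts. -/
def deficit (n : ℕ) (φ : ℕ → ℕ) : ℕ :=
  ∑ i ∈ Finset.Icc 1 n, (n - φ i)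

theorem deficit_lt (hψ : MapsTo ψ (Icc 1 n) (Icc 1 n)) (hle : ∀ i ∈ Icc 1 n, φ i ≤ ψ i) {k : ℕ}
    (hk : k ∈ Icc 1 n) (hlt : φ k < ψ k) : deficit n ψ < deficit n φ := by
  refine Finset.sum_lt_sum (fun i hi => ?_) ⟨k, Finset.mem_Icc.2 hk, ?_⟩
  · exact Nat.sub_le_sub_left (hle i (Finset.mem_Icc.1 hi)) n
  · exact Nat.sub_lt_sub_left (hlt.trans_le (hψ hk).2) hlt

namespace IsUnitStepMap

theorem monotoneOn (hφ : IsUnitStepMap n φ) : MonotoneOn φ (Icc 1 n) := by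
  rintro i ⟨hi, -⟩ k ⟨-, hk⟩ hik
  induction k, hik using Nat.le_induction with
  | base => rfl
  | succ k hik ih =>
    have := ih (by lia)
    have := hφ.succ_eq_or k (by lia) hk
    lia

theorem add_one (hφ : IsUnitStepMap n φ) (hn : φ n < n) : IsUnitStepMap n fun i => φ i + 1 where
  mapsTo i hi := by
    have := hφ.monotoneOn hi ⟨hi.1.trans hi.2, le_rfl⟩ hi.2
    exact ⟨by lia, by lia⟩
  succ_eq_or i hi hin := by
    have := hφ.succ_eq_or i hi hin
    lia

theorem shift (hφ : IsUnitStepMap n φ) : IsUnitStepMap n fun i => φ (min (i + 1) n) where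
  mapsTo _ hi := hφ.mapsTo (mapsTo_letterMap .a hi)
  succ_eq_or i _ _ := by
    rcases Nat.lt_or_ge (i + 1) n with hlt | hge
    · rw [min_eq_left (by lia), min_eq_left (by lia)]
      exact hφ.succ_eq_or (i + 1) (by lia) hlt
    · rw [min_eq_right (by lia), min_eq_right (by lia)]
      exact .inl rfl

theorem update (hφ : IsUnitStepMap n φ) {k : ℕ} (hk : k + 1 < n)
    (hflat : φ (k + 1) = φ k) (hrise : φ (k + 2) = φ (k + 1) + 1) :
    IsUnitStepMap n (Function.update φ (k + 1) (φ (k + 2))) where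
  mapsTo i hi := by
    rw [Function.update_apply]
    split_ifs
    · exact hφ.mapsTo ⟨by lia, by lia⟩
    · exact hφ.mapsTo hi
  succ_eq_or i hi1 hi := by
    have := hφ.succ_eq_or i hi1 hi
    simp only [Function.update_apply]
    grind

theorem isWordMap_of_forall_flat (hφ : IsUnitStepMap n φ) (hn : n ≤ φ n)
    (hflat : ∀ k, 1 ≤ k → k + 1 < n → φ (k + 1) = φ k → φ (k + 2) = φ (k + 1)) :
    IsWordMap n φ := by
  have hend (i : ℕ) (h1 : 1 ≤ i) (hi : i < n) (h : φ (i + 1) = φ i) : n ≤ φ i := by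
    suffices hconst : ∀ k, i + 1 ≤ k → k ≤ n → φ k = φ i ∧ φ (k - 1) = φ i from
      hn.trans_eq (hconst n hi le_rfl).1
    intro k hik
    induction k, hik using Nat.le_induction with
    | base => exact fun _ => ⟨h, rfl⟩
    | succ k hik ih =>
      intro hk
      obtain ⟨m, rfl⟩ : ∃ m, k = m + 1 := ⟨k - 1, by lia⟩
      obtain ⟨h2, h3⟩ := ih (by lia)
      exact ⟨(hflat m (by lia) hk (h2.trans h3.symm)).trans h2, h2⟩
  refine ⟨.replicate (φ 1 - 1) .a, fun i hi => ?_⟩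
  obtain ⟨h1, hi⟩ := hi
  rw [wordMap_replicate_a hi]
  induction i, h1 using Nat.le_induction with
  | base =>
    obtain ⟨hlow, hhigh⟩ := hφ.mapsTo ⟨le_rfl, hi⟩
    lia
  | succ i h1 ih =>
    have hprev := ih (by lia)
    have hhigh := (hφ.mapsTo ⟨(by lia : 1 ≤ i + 1), hi⟩).2
    rcases hφ.succ_eq_or i h1 hi with hflat | hrise
    · have := hend i h1 hi hflat
      lia
    · lia

theorem isWordMap (hφ : IsUnitStepMap n φ) : IsWordMap n φ := by
  induction hd : deficit n φ using Nat.strong_induction_on generalizing φ with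
  | _ d ih =>
  subst hd
  replace ih (ψ : ℕ → ℕ) (hψ : IsUnitStepMap n ψ) (hle : ∀ i ∈ Icc 1 n, φ i ≤ ψ i) (k : ℕ)
      (hk : k ∈ Icc 1 n) (hlt : φ k < ψ k) : IsWordMap n ψ :=
    ih _ (deficit_lt hψ.mapsTo hle hk hlt) hψ rfl
  rcases lt_or_ge (φ n) n with htop | htop
  · refine (ih _ (hφ.add_one htop) (fun i _ => Nat.le_succ _) n ⟨by lia, le_rfl⟩
      (Nat.lt_succ_self _)).letterMap_comp .b fun i hi => ?_
    have := (hφ.mapsTo hi).1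
    simp only [Function.comp_apply, letterMap]
    lia
  by_cases hflat : ∀ k, 1 ≤ k → k + 1 < n → φ (k + 1) = φ k → φ (k + 2) = φ (k + 1)
  · exact hφ.isWordMap_of_forall_flat htop hflat
  push Not at hflat
  obtain ⟨k, h1, hk, hflat, hne⟩ := hflat
  have hrise := (hφ.succ_eq_or (k + 1) (by lia) hk).resolve_left hne
  rcases h1.eq_or_lt with rfl | h1
  · refine (ih _ hφ.shift (fun i hi => hφ.monotoneOn hi (mapsTo_letterMap .a hi) ?_) 2
      ⟨by lia, by lia⟩ ?_).comp_letterMap .b fun i hi => ?_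
    · exact le_min (Nat.le_succ i) hi.2
    · rw [min_eq_left (by lia)]
      lia
    · simp only [Function.comp_apply, letterMap]
      grind
  · refine (ih _ (hφ.update hk hflat hrise) (fun i _ => ?_) (k + 1) ⟨by lia, by lia⟩
      ?_).comp_letterMap (.c (k + 1) (by lia) (by lia)) fun i _ => ?_
    · rw [Function.update_apply]
      grind
    · rw [Function.update_self]
      lia
    · simp only [Function.comp_apply, letterMap, Function.update_apply]
      grind

end IsUnitStepMap

/-- A map with unit steps for which `parityLift S i` is even exactly when `i ∈ S` (for `i ≥ 1`; the
value at `0` only starts the recursion). -/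
noncomputable def parityLift (S : Set ℕ) : ℕ → ℕ
  | 0 => 1
  | i + 1 =>
    open Classical in
    if Even (parityLift S i) ↔ i + 1 ∈ S then parityLift S i else parityLift S i + 1

section ParityLift

variable (S : Set ℕ)

theorem parityLift_succ_eq_or (i : ℕ) :
    parityLift S (i + 1) = parityLift S i ∨ parityLift S (i + 1) = parityLift S i + 1 := by
  rw [parityLift]
  split_ifs
  · exact .inl rfl
  · exact .inr rfl

theorem one_le_parityLift (i : ℕ) : 1 ≤ parityLift S i := by
  induction i with
  | zero => rfl
  | succ i ih => have := parityLift_succ_eq_or S i; lia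

theorem parityLift_add_le (i k : ℕ) : parityLift S (i + k) ≤ parityLift S i + k := by
  induction k with
  | zero => rfl
  | succ k ih => have := parityLift_succ_eq_or S (i + k); lia

theorem monotone_parityLift : Monotone (parityLift S) :=
  monotone_nat_of_le_succ fun i => by have := parityLift_succ_eq_or S i; lia

theorem even_parityLift_iff {i : ℕ} (hi : 1 ≤ i) : Even (parityLift S i) ↔ i ∈ S := by
  obtain ⟨i, rfl⟩ := Nat.exists_eq_add_of_le' hi
  rw [parityLift]
  split_ifs with h
  · exact h
  · rw [Nat.even_add_one]
    tauto

theorem isUnitStepMap_parityLift (hS : ∃ i ∈ Icc 1 n, ¬(i ∈ S ↔ Odd i)) :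
    IsUnitStepMap n (parityLift S) where
  mapsTo k hk := by
    obtain ⟨i, hi, hiS⟩ := hS
    refine ⟨one_le_parityLift S k, (monotone_parityLift S hk.2).trans ?_⟩
    have hne : parityLift S i ≠ i + 1 := fun h => hiS <| by
      rw [← even_parityLift_iff S hi.1, h, Nat.even_add_one, Nat.not_even_iff_odd]
    have hle : parityLift S (0 + i) ≤ 1 + i := parityLift_add_le S 0 i
    have hrest := parityLift_add_le S i (n - i)
    rw [Nat.add_sub_cancel' hi.2] at hrest
    rw [zero_add] at hle
    have := hi.2
    lia
  succ_eq_or i _ _ := parityLift_succ_eq_or S i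

end ParityLift

theorem exists_even_wordMap_iff {S : Set ℕ} (hS : ∃ i ∈ Icc 1 n, ¬(i ∈ S ↔ Odd i)) :
    ∃ w, ∀ i ∈ Icc 1 n, Even (wordMap n w i) ↔ i ∈ S := by
  obtain ⟨w, hw⟩ := (isUnitStepMap_parityLift S hS).isWordMap
  exact ⟨w, fun i hi => by rw [hw hi, even_parityLift_iff S hi.1]⟩

theorem exists_not_even_iff_odd_of_monotoneOn (hn : 1 ≤ n) (hφ : MonotoneOn φ (Icc 1 n))
    (hmaps : MapsTo φ (Icc 1 n) (Icc 1 n)) : ∃ i ∈ Icc 1 n, ¬(Even (φ i) ↔ Odd i) := by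
  by_contra! hparity
  suffices hlt : ∀ i, 1 ≤ i → i ≤ n → i < φ i from
    (hlt n hn le_rfl).not_ge (hmaps ⟨hn, le_rfl⟩).2
  intro i h1
  induction i, h1 using Nat.le_induction with
  | base =>
    intro h1
    have := (hmaps ⟨le_rfl, h1⟩).1
    have := hparity 1 ⟨le_rfl, h1⟩
    grind
  | succ i h1 ih =>
    intro hi
    have := ih (by lia)
    have := hφ ⟨h1, by lia⟩ ⟨by lia, hi⟩ (Nat.le_succ i)
    have := hparity (i + 1) ⟨by lia, hi⟩
    grind

end ChainMaps

section ChainDFA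

variable {n : ℕ}

/-- The automaton `reversalDFA` without the assumption `3 ≤ n`, with its transitions written as
truncations. -/
def chainDFA (n : ℕ) (hn : 1 ≤ n) : DFA (ReversalLetter n) (Set.Icc 1 n) where
  step i x := ⟨letterMap n x i, mapsTo_letterMap x i.2⟩
  start := ⟨1, le_rfl, hn⟩
  accept := {i | Even i.1}

theorem reversalDFA_eq_chainDFA (hn : 3 ≤ n) : reversalDFA n hn = chainDFA n (by lia) := by
  have hstep : (reversalDFA n hn).step = (chainDFA n (by lia)).step := by
    funext ⟨i, hi1, hin⟩ x
    apply Subtype.ext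
    cases x <;> simp only [reversalDFA, chainDFA, letterMap] <;> split_ifs <;> grind
  exact congrArg (DFA.mk · _ _) hstep

variable (hn : 1 ≤ n)

theorem monotone_chainDFA_step (x : ReversalLetter n) :
    Monotone ((chainDFA n hn).step · x) :=
  fun _ _ hpq => monotone_letterMap x hpq

theorem coe_evalFrom_chainDFA (q : Set.Icc 1 n) (w : List (ReversalLetter n)) :
    ((chainDFA n hn).evalFrom q w : ℕ) = wordMap n w q := by
  induction w generalizing q with
  | nil => rfl
  | cons _ _ ih => exact ih _

theorem eval_chainDFA_surjective : Function.Surjective (chainDFA n hn).eval := by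
  rintro ⟨q, hq1, hqn⟩
  refine ⟨.replicate (q - 1) .a, Subtype.ext ?_⟩
  rw [DFA.eval, coe_evalFrom_chainDFA, wordMap_replicate_a (i := (chainDFA n hn).start) hn]
  change min (1 + (q - 1)) n = q
  lia

theorem mem_acceptingStates_chainDFA {q : Set.Icc 1 n} {w : List (ReversalLetter n)} :
    q ∈ acceptingStates (chainDFA n hn) w ↔ Even (wordMap n w q) := by
  rw [← coe_evalFrom_chainDFA hn]
  rfl

theorem range_acceptingStates_chainDFA :
    Set.range (acceptingStates (chainDFA n hn)) = {{q | Odd q.1}}ᶜ := by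
  ext S
  rw [Set.mem_compl_singleton_iff, ne_eq, Set.ext_iff, not_forall]
  constructor
  · rintro ⟨w, rfl⟩
    obtain ⟨q, hq, hqw⟩ := exists_not_even_iff_odd_of_monotoneOn hn
      ((monotone_wordMap w).monotoneOn _) (mapsTo_wordMap w)
    exact ⟨⟨q, hq⟩, fun h => hqw ((mem_acceptingStates_chainDFA hn).symm.trans h)⟩
  · rintro ⟨q, hq⟩
    have hS : ∃ i ∈ Set.Icc 1 n, ¬(i ∈ Subtype.val '' S ↔ Odd i) :=
      ⟨q, q.2, by rwa [Subtype.val_injective.mem_set_image]⟩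
    obtain ⟨w, hw⟩ := exists_even_wordMap_iff hS
    refine ⟨w, Set.ext fun p => ?_⟩
    rw [mem_acceptingStates_chainDFA, hw p p.2, Subtype.val_injective.mem_set_image]

theorem acceptsFrom_chainDFA_injective : Function.Injective (chainDFA n hn).acceptsFrom := by
  have hiff {p q : Set.Icc 1 n}
      (h : (chainDFA n hn).acceptsFrom p = (chainDFA n hn).acceptsFrom q)
      {S : Set (Set.Icc 1 n)} (hS : S ≠ {q | Odd q.1}) : p ∈ S ↔ q ∈ S := by
    obtain ⟨w, rfl⟩ : S ∈ Set.range (acceptingStates (chainDFA n hn)) := by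
      rwa [range_acceptingStates_chainDFA]
    exact Iff.of_eq (congrArg (w ∈ ·) h)
  have hle {p q : Set.Icc 1 n}
      (h : (chainDFA n hn).acceptsFrom p = (chainDFA n hn).acceptsFrom q) : q ≤ p := by
    refine not_lt.1 fun hpq => lt_irrefl p ((hiff (S := Set.Ioi p) h fun hodd => ?_).2 hpq)
    have hone : (⟨1, le_rfl, hn⟩ : Set.Icc 1 n) ∈ Set.Ioi p := hodd ▸ odd_one
    exact hone.not_ge p.2.1
  exact fun p q h => (hle h.symm).antisymm (hle h)

theorem quotientComplexity_accepts_chainDFA : quotientComplexity (chainDFA n hn).accepts = n := by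
  rw [quotientComplexity_accepts _ (eval_chainDFA_surjective hn)
    (acceptsFrom_chainDFA_injective hn), ENat.card_eq_coe_fintype_card]
  simp

theorem encard_compl_singleton_set {σ : Type*} [Fintype σ] (S : Set σ) :
    ({S}ᶜ : Set (Set σ)).encard = (2 ^ Fintype.card σ - 1 : ℕ) := by
  classical
  have hcoe : ({S}ᶜ : Set (Set σ)) = ↑({S}ᶜ : Finset (Set σ)) := by
    rw [Finset.coe_compl, Finset.coe_singleton]
  rw [hcoe, Set.encard_coe_eq_coe_finsetCard, Finset.card_compl, Finset.card_singleton,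
    Fintype.card_set]

theorem quotientComplexity_reverse_accepts_chainDFA :
    quotientComplexity (chainDFA n hn).accepts.reverse = (2 ^ n - 1 : ℕ) := by
  rw [quotientComplexity_reverse_accepts _ (eval_chainDFA_surjective hn),
    range_acceptingStates_chainDFA, encard_compl_singleton_set]
  simp

end ChainDFA

/-- The letters `a`, `b` and the indices of the letters `c_j`; used to count the alphabet. -/
def reversalLetterEquiv (n : ℕ) : ReversalLetter n ≃ Bool ⊕ Finset.Icc 3 (n - 1) where
  toFun
    | .a => .inl true
    | .b => .inl false
    | .c j h3 hj => .inr ⟨j, Finset.mem_Icc.2 ⟨h3, hj⟩⟩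
  invFun
    | .inl true => .a
    | .inl false => .b
    | .inr j => .c j.1 (Finset.mem_Icc.1 j.2).1 (Finset.mem_Icc.1 j.2).2
  left_inv x := by cases x <;> rfl
  right_inv x := by rcases x with (_ | _) | _ <;> rfl

instance (n : ℕ) : Finite (ReversalLetter n) :=
  .of_equiv _ (reversalLetterEquiv n).symm

theorem natCard_reversalLetter {n : ℕ} : Nat.card (ReversalLetter n) = 2 + (n - 3) := by
  rw [Nat.card_congr (reversalLetterEquiv n), Nat.card_eq_fintype_card]
  simp only [Fintype.card_sum, Fintype.card_bool, Fintype.card_coe, Nat.card_Icc]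
  lia

instance (n : ℕ) : Nonempty (ReversalLetter n) :=
  ⟨.a⟩

theorem exists_surjective_of_natCard_le {α β : Type*} [Finite α] [Finite β] [Nonempty β]
    (h : Nat.card β ≤ Nat.card α) : ∃ g : α → β, Function.Surjective g := by
  have := Fintype.ofFinite α
  have := Fintype.ofFinite β
  rw [Nat.card_eq_fintype_card, Nat.card_eq_fintype_card] at h
  obtain ⟨e⟩ := Function.Embedding.nonempty_of_card_le h
  exact ⟨_, Function.invFun_surjective e.injective⟩

theorem theorem5 (n : ℕ) (hn : 1 ≤ n) :
    (∀ (α : Type*) [Fintype α],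
      (n = 1 → 1 ≤ Fintype.card α) → (n = 2 → 2 ≤ Fintype.card α) →
      (3 ≤ n → n - 1 ≤ Fintype.card α) →
      ∃ L : Language α, IsStarFree L ∧ quotientComplexity L = n ∧
        quotientComplexity L.reverse = (2 ^ n - 1 : ℕ)) ∧
    (∀ h : 3 ≤ n,
      Nat.card (ReversalLetter n) = n - 1 ∧
      IsStarFree (reversalDFA n h).accepts ∧
      quotientComplexity (reversalDFA n h).accepts = n ∧
      quotientComplexity (reversalDFA n h).accepts.reverse = (2 ^ n - 1 : ℕ)) := by
  refine ⟨fun α _ _ h2 h3 => ?_, fun h => ⟨?_, ?_⟩⟩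
  · rcases hn.eq_or_lt with rfl | hn'
    · refine ⟨0, IsStarFree.zero, quotientComplexity_zero, ?_⟩
      rw [Language.reverse_zero, quotientComplexity_zero]
      norm_num
    · obtain ⟨g, hg⟩ := exists_surjective_of_natCard_le (α := α) (β := ReversalLetter n)
        (by rw [natCard_reversalLetter, Nat.card_eq_fintype_card]; lia)
      refine ⟨letterPreimage g (chainDFA n hn).accepts, ?_, ?_, ?_⟩
      · rw [← accepts_comap_eq_letterPreimage]
        exact isStarFree_accepts_of_monotone fun x => monotone_chainDFA_step hn (g x)
      · rw [quotientComplexity_letterPreimage hg, quotientComplexity_accepts_chainDFA]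
      · rw [reverse_letterPreimage, quotientComplexity_letterPreimage hg,
          quotientComplexity_reverse_accepts_chainDFA]
  · rw [natCard_reversalLetter]
    lia
  · rw [reversalDFA_eq_chainDFA]
    exact ⟨isStarFree_accepts_of_monotone (monotone_chainDFA_step _),
      quotientComplexity_accepts_chainDFA _, quotientComplexity_reverse_accepts_chainDFA _⟩
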